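/- For an integer $k$ let $(a)_k=\Gamma(a+k)/\Gamma(a)$ be the Pochhammer symbol, so that $(a)_{-j}=1/((a-1)(a-2)\cdots(a-j))$ for $j>0$, and let $$G_3(a,b|x,y)=\sum_{m,n\ge 0}\frac{(a)_{2n-m}\,(b)_{2m-n}}{m!\,n!}\,x^m y^n$$ be the Horn function. For $r\in\mathbb C$ the coefficients of $G_3(s,1-s|x,y)$ have finite limits as $s\to r$ (equal to the coefficients of $G_3(r,1-r|x,y)$ if $r\notin\mathbb Z$); for $r\in\mathbb Z$ the series $G_3(r,1-r|x,y)$ is understood with these limits as its coefficients. Put $$\Delta(x,y)=1+4x+4y+18xy-27x^2y^2,\qquad g(x,y)=-3y^2f(x,y)^2-2yf(x,y)+4y+1,$$ where $f$ is a holomorphic solution of $$y f(x,y)^3+f(x,y)^2-f(x,y)-x=0,\qquad f(0,0)=1 .$$ Then, for every $r\in\mathbb C$, $$G_3(r,1-r|x,y)=f(x,y)^r\sqrt{\frac{g(x,y)}{\Delta(x,y)}},$$ in the following sense. (a) There are $\rho>0$, independent of $r$, and such an $f$ on the bidisc $|x|<\rho$, $|y|<\rho$, for which $\Delta\neq 0$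 and neither $f$ nor $g/\Delta$ takes values in $(-\infty,0]$; for all $r\in\mathbb C$ and all $(x,y)$ in this bidisc the series converges absolutely and the formula holds with the principal branches of the power and the square root. (b) Let $r\in\mathbb C$, let $U\subseteq\mathbb C^2$ be a connected open set containing $(0,0)$ at every point of which the series $G_3(r,1-r|x,y)$ converges absolutely, and let $f,\ell,s$ be holomorphic on $U$ such that $f$ satisfies the cubic equation with $f(0,0)=1$, $e^{\ell}=f$ with $\ell(0,0)=0$, and $s^2\Delta=g$ with $s(0,0)=1$. Then $G_3(r,1-r|x,y)=e^{r\ell(x,y)}\,s(x,y)$ on $U$. -/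

import Mathlib

open Filter Topology

noncomputable section

/-- The Pochhammer symbol `(a)_k = Γ(a + k) / Γ(a)` with an integer index `k`, as a product:
`a (a + 1) ⋯ (a + k - 1)` for `k ≥ 0`, and `1 / ((a - 1) (a - 2) ⋯ (a - j))` for `k = -j < 0`. -/
def intPochhammer (a : ℂ) : ℤ → ℂ
  | Int.ofNat k => ∏ i ∈ Finset.range k, (a + i)
  | Int.negSucc k => (∏ i ∈ Finset.range (k + 1), (a - (i + 1)))⁻¹

/-- The coefficient of `x ^ m * y ^ n` in the Horn series
`G₃(a, b | x, y) = ∑ (a)_{2n-m} (b)_{2m-n} / (m! n!) x ^ m y ^ n`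
(meaningful when neither `a` nor `b` makes a Pochhammer symbol with negative index infinite,
in particular when `a` and `b` are not integers). -/
def hornG3Coeff (a b : ℂ) (m n : ℕ) : ℂ :=
  intPochhammer a (2 * (n : ℤ) - m) * intPochhammer b (2 * (m : ℤ) - n) /
    ((m.factorial : ℂ) * (n.factorial : ℂ))

/-- The coefficient of `x ^ m * y ^ n` in `G₃(r, 1 - r | x, y)`, for every complex `r`, integers
included, by continuity in the parameter. -/
def hornG3DiagCoeff (r : ℂ) (m n : ℕ) : ℂ :=
  limUnder (𝓝[≠] r) fun s : ℂ => hornG3Coeff s (1 - s) m n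

/-- The terms of the double series `G₃(r, 1 - r | x, y)`. -/
def hornG3DiagTerm (r x y : ℂ) (k : ℕ × ℕ) : ℂ :=
  hornG3DiagCoeff r k.1 k.2 * x ^ k.1 * y ^ k.2

/-- `g` as a polynomial in `y` and the value `f` of the root of the cubic. -/
def g3G (y f : ℂ) : ℂ := -3 * y ^ 2 * f ^ 2 - 2 * y * f + 4 * y + 1

/-- The discriminant `Δ(x, y)`. -/
def g3Delta (x y : ℂ) : ℂ := 1 + 4 * x + 4 * y + 18 * x * y - 27 * x ^ 2 * y ^ 2

/-- `f` is a holomorphic root of the cubic on `U`, on the branch with `f(0,0) = 1`. -/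
structure IsG3Root (U : Set (ℂ × ℂ)) (f : ℂ × ℂ → ℂ) : Prop where
  holo : DifferentiableOn ℂ f U
  cubic : ∀ p ∈ U, p.2 * f p ^ 3 + f p ^ 2 - f p - p.1 = 0
  base : f (0, 0) = 1

end

/-! ### The coefficients -/

/-! Reflection of the Pochhammer symbols turns the coefficients into `(-1)^n` times a binomial
coefficient of `m + n` over `m` times the Taylor coefficient of order `m + n` at `z = 1` of
`z^(r-1+2n-m)`. Cauchy's formula writes them as integrals over `|z - 1| = 1/2`, and summing under
the integral with `∑ (m+n choose m) A^m B^n = 1/(1-A-B)`, where `A = x/(z(z-1))` and `B = -y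
z^2/(z-1)`, leaves the integrand `z^r / P(z)` with `P(z) = y z^3 + z^2 - z - x`. For small `x, y`
the only pole inside is the root `f`, so the sum is `f^r / P'(f)` (`hasSum_hornG3DiagTerm_of_root`).
The discriminant identity `g * P'(f)^2 = Δ` (`g3G_mul_sq_eq_g3Delta`) turns `1/P'(f)` into the
square root. This gives (a); (b) follows from the local formula by the identity theorem
`eq_zero_of_differentiableAt_lines`. -/

theorem prod_range_neg (N : ℕ) (u : ℕ → ℂ) :
    ∏ i ∈ Finset.range N, -u i = (-1) ^ N * ∏ i ∈ Finset.range N, u i := by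
  rw [Finset.prod_neg, Finset.card_range]

theorem intPochhammer_add_one {a : ℂ} (ha : ∀ k : ℤ, a ≠ k) (j : ℤ) :
    intPochhammer a (j + 1) = intPochhammer a j * (a + j) := by
  rcases j with j | _ | j
  · change intPochhammer a (Int.ofNat (j + 1)) = _
    simp [intPochhammer, Finset.prod_range_succ]
  -- Index `-1`, where the two clauses of the definition meet.
  · have h : a - 1 ≠ 0 := sub_ne_zero.2 (by exact_mod_cast ha 1)
    change intPochhammer a (Int.ofNat 0) = _
    simp only [intPochhammer, Finset.range_zero, Finset.prod_empty, zero_add, Finset.range_one,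
      Finset.prod_singleton, Int.cast_negSucc]
    simp [← sub_eq_add_neg, inv_mul_cancel₀ h]
  · have h : a - (((j + 1 : ℕ) : ℂ) + 1) ≠ 0 := sub_ne_zero.2 (by exact_mod_cast ha (j + 1 + 1))
    have e : Int.negSucc (j + 1) + 1 = Int.negSucc j := by omega
    have e' : a + ((Int.negSucc (j + 1) : ℤ) : ℂ) = a - (((j + 1 : ℕ) : ℂ) + 1) := by
      rw [Int.cast_negSucc]; push_cast; ring
    rw [e, e']
    simp only [intPochhammer]
    rw [Finset.prod_range_succ _ (j + 1), mul_inv, mul_assoc, inv_mul_cancel₀ h, mul_one]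

theorem intPochhammer_add_natCast {a : ℂ} (ha : ∀ k : ℤ, a ≠ k) (j : ℤ) (N : ℕ) :
    intPochhammer a (j + N) = intPochhammer a j * ∏ i ∈ Finset.range N, (a + j + i) := by
  induction N with
  | zero => simp
  | succ N ih =>
    rw [Nat.cast_succ, ← add_assoc, intPochhammer_add_one ha, ih, Finset.prod_range_succ]
    push_cast
    ring

/-- The two symbols have the same factors up to sign, one as a product and the other as its
reciprocal. -/
theorem intPochhammer_mul_intPochhammer_one_sub_neg {a : ℂ} (ha : ∀ k : ℤ, a ≠ k) (k : ℤ) :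
    intPochhammer a k * intPochhammer (1 - a) (-k) = (-1) ^ k := by
  rcases k with k | k
  · rcases k with _ | k
    · simp [intPochhammer]
    · have h : ∏ i ∈ Finset.range (k + 1), (a + i) ≠ 0 :=
        Finset.prod_ne_zero_iff.2 fun i _ h => ha (-i) (by push_cast; linear_combination h)
      have e : ∏ i ∈ Finset.range (k + 1), (1 - a - ((i : ℂ) + 1)) =
          (-1) ^ (k + 1) * ∏ i ∈ Finset.range (k + 1), (a + i) := by
        rw [← prod_range_neg]
        exact Finset.prod_congr rfl fun i _ => by ring
      change _ * intPochhammer (1 - a) (Int.negSucc k) = _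
      simp only [intPochhammer, e, Int.ofNat_eq_natCast, zpow_natCast]
      rw [mul_inv, mul_left_comm, mul_inv_cancel₀ h, mul_one, ← inv_pow]
      norm_num
  · have h : ∏ i ∈ Finset.range (k + 1), (a - ((i : ℂ) + 1)) ≠ 0 :=
      Finset.prod_ne_zero_iff.2 fun i _ h => ha (i + 1) (by push_cast; linear_combination h)
    have e : ∏ i ∈ Finset.range (k + 1), (1 - a + (i : ℂ)) =
        (-1) ^ (k + 1) * ∏ i ∈ Finset.range (k + 1), (a - ((i : ℂ) + 1)) := by
      rw [← prod_range_neg]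
      exact Finset.prod_congr rfl fun i _ => by ring
    change _ * intPochhammer (1 - a) (Int.ofNat (k + 1)) = _
    simp only [intPochhammer, e, zpow_negSucc]
    rw [mul_left_comm, inv_mul_cancel₀ h, mul_one, ← inv_pow]
    norm_num

/-- The coefficient of `x ^ m * y ^ n` in `G₃(r, 1 - r | x, y)` as a polynomial in `r`, namely
`(-1) ^ n * (r - 1 + 2 n - m choose m + n) * (m + n choose m)`. -/
noncomputable def hornG3PolyCoeff (r : ℂ) (m n : ℕ) : ℂ :=
  (-1) ^ n * (∏ i ∈ Finset.range (m + n), (r - 1 + 2 * n - m - i)) /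
    ((m.factorial : ℂ) * (n.factorial : ℂ))

theorem hornG3Coeff_eq_polyCoeff {s : ℂ} (hs : ∀ k : ℤ, s ≠ k) (m n : ℕ) :
    hornG3Coeff s (1 - s) m n = hornG3PolyCoeff s m n := by
  have hs' : ∀ k : ℤ, 1 - s ≠ k := fun k h =>
    hs (1 - k) (by push_cast; linear_combination -h)
  -- After this split, reflection cancels the symbol in `s` against the first part, so no
  -- denominator in `s` survives; the other `m + n` factors are polynomial in `s`.
  have e : 2 * (m : ℤ) - n = -(2 * (n : ℤ) - m) + (m + n : ℕ) := by push_cast; ring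
  have sgn : (-1 : ℂ) ^ (2 * (n : ℤ) - m) = (-1) ^ m := by
    rw [zpow_sub₀ (by norm_num), zpow_mul]
    norm_num [← inv_pow]
  have p : ∏ i ∈ Finset.range (m + n), (1 - s + ((-(2 * (n : ℤ) - m) : ℤ) : ℂ) + i) =
      (-1) ^ (m + n) * ∏ i ∈ Finset.range (m + n), (s - 1 + 2 * n - m - i) := by
    rw [← prod_range_neg]
    exact Finset.prod_congr rfl fun i _ => by push_cast; ring
  rw [hornG3Coeff, hornG3PolyCoeff, e, intPochhammer_add_natCast hs', ← mul_assoc,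
    intPochhammer_mul_intPochhammer_one_sub_neg hs, sgn, p, ← mul_assoc, ← pow_add,
    show m + (m + n) = 2 * m + n by ring, pow_add _ (2 * m), pow_mul]
  norm_num

theorem eventually_ne_intCast (r : ℂ) : ∀ᶠ s : ℂ in 𝓝[≠] r, ∀ k : ℤ, s ≠ k := by
  by_cases h : ∃ k : ℤ, r = k
  · obtain ⟨k, rfl⟩ := h
    filter_upwards [self_mem_nhdsWithin,
      mem_nhdsWithin_of_mem_nhds (Metric.ball_mem_nhds (k : ℂ) one_pos)] with s hs hs' j hj
    subst hj
    rw [mem_ball_iff_norm, ← Int.cast_sub, Complex.norm_intCast, ← Int.cast_abs] at hs'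
    have : |j - k| < 1 := by exact_mod_cast hs'
    exact hs (by rw [sub_eq_zero.1 (Int.abs_lt_one_iff.1 this)]; rfl)
  · push Not at h
    have : IsOpen (Set.range ((↑) : ℤ → ℂ))ᶜ := Complex.isOpen_compl_range_intCast
    filter_upwards [mem_nhdsWithin_of_mem_nhds
      (this.mem_nhds fun ⟨k, hk⟩ => h k hk.symm)] with s hs k hk
    exact hs ⟨k, hk.symm⟩

theorem tendsto_hornG3Coeff (r : ℂ) (m n : ℕ) :
    Tendsto (fun s : ℂ => hornG3Coeff s (1 - s) m n) (𝓝[≠] r) (𝓝 (hornG3PolyCoeff r m n)) := by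
  have hc : Continuous fun s => hornG3PolyCoeff s m n := by
    unfold hornG3PolyCoeff
    fun_prop
  refine (hc.continuousAt.tendsto.mono_left nhdsWithin_le_nhds).congr' ?_
  filter_upwards [eventually_ne_intCast r] with s hs
  exact (hornG3Coeff_eq_polyCoeff hs m n).symm

theorem hornG3DiagCoeff_eq_polyCoeff (r : ℂ) (m n : ℕ) :
    hornG3DiagCoeff r m n = hornG3PolyCoeff r m n :=
  (tendsto_hornG3Coeff r m n).limUnder_eq

/-! ### The generating function as a contour integral -/

theorem iteratedDeriv_cpow_const (α : ℂ) (N : ℕ) {z : ℂ} (hz : z ∈ Complex.slitPlane) :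
    iteratedDeriv N (fun z : ℂ => z ^ α) z =
      (∏ i ∈ Finset.range N, (α - i)) * z ^ (α - N) := by
  induction N generalizing z with
  | zero => simp
  | succ N ih =>
    have h : iteratedDeriv N (fun z : ℂ => z ^ α) =ᶠ[𝓝 z]
        fun z => (∏ i ∈ Finset.range N, (α - i)) * z ^ (α - N) := by
      filter_upwards [Complex.isOpen_slitPlane.mem_nhds hz] with w hw using ih hw
    rw [iteratedDeriv_succ, h.deriv_eq,
      (((hasDerivAt_id' z).cpow_const (c := α - N) hz).const_mul _).deriv, Finset.prod_range_succ]
    simp only [Nat.cast_succ, mul_one, sub_sub, mul_assoc]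

theorem summable_choose_mul_pow_mul_pow {a b : ℝ} (ha : 0 ≤ a) (hb : 0 ≤ b) (hab : a + b < 1) :
    Summable fun k : ℕ × ℕ => ((k.1 + k.2).choose k.1 : ℝ) * a ^ k.1 * b ^ k.2 := by
  have hb1 : ‖b‖ < 1 := by rw [Real.norm_of_nonneg hb]; linarith
  have hs (m : ℕ) : HasSum (fun n : ℕ => ((m + n).choose m : ℝ) * a ^ m * b ^ n)
      ((1 - b)⁻¹ * (a / (1 - b)) ^ m) := by
    convert! (hasSum_choose_mul_geometric_of_norm_lt_one m hb1).mul_left (a ^ m) using 1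
    · ext n; rw [add_comm m n]; ring
    · rw [div_pow, pow_succ]; field_simp
  refine (summable_prod_of_nonneg fun k => by positivity).2 ⟨fun m => (hs m).summable, ?_⟩
  simp only [(hs _).tsum_eq]
  refine (summable_geometric_of_lt_one (div_nonneg ha (by linarith)) ?_).mul_left _
  rw [div_lt_one (by linarith)]
  linarith

/-- The sum over `n` is a negative binomial series; what remains is geometric in `m` with ratio
`A/(1-B)`. -/
theorem hasSum_choose_mul_pow_mul_pow {A B : ℂ} (hAB : ‖A‖ + ‖B‖ < 1) :
    HasSum (fun k : ℕ × ℕ => ((k.1 + k.2).choose k.1 : ℂ) * A ^ k.1 * B ^ k.2)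
      (1 - A - B)⁻¹ := by
  have hA := norm_nonneg A
  have hB1 : ‖B‖ < 1 := by linarith
  have hB : 1 - ‖B‖ ≤ ‖1 - B‖ := by simpa using norm_sub_norm_le 1 B
  have hB0 : 1 - B ≠ 0 := norm_pos_iff.1 (by linarith)
  have hs (m : ℕ) : HasSum (fun n : ℕ => ((m + n).choose m : ℂ) * A ^ m * B ^ n)
      ((1 - B)⁻¹ * (A / (1 - B)) ^ m) := by
    convert! (hasSum_choose_mul_geometric_of_norm_lt_one m hB1).mul_left (A ^ m) using 1
    · ext n; rw [add_comm m n]; ring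
    · rw [div_pow, pow_succ]; field_simp
  have hsum : Summable fun k : ℕ × ℕ => ((k.1 + k.2).choose k.1 : ℂ) * A ^ k.1 * B ^ k.2 :=
    .of_norm (by simpa using summable_choose_mul_pow_mul_pow hA (norm_nonneg B) hAB)
  have hq : ‖A / (1 - B)‖ < 1 := by
    rw [norm_div, div_lt_one (by linarith)]
    linarith
  have h := (hasSum_geometric_of_norm_lt_one hq).mul_left (1 - B)⁻¹
  have := (hsum.hasSum.prod_fiberwise hs).unique h
  convert hsum.hasSum using 1
  rw [this, ← mul_inv, mul_sub, mul_div_cancel₀ _ hB0, mul_one]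
  congr 1
  ring

theorem hasSum_circleIntegral_of_summable_norm {ι : Type*} [Countable ι] {c : ℂ} {R : ℝ}
    (hR : 0 ≤ R) {F : ι → ℂ → ℂ} {G : ℂ → ℂ} {u : ι → ℝ} (hu : Summable u)
    (hF : ∀ i, ContinuousOn (F i) (Metric.sphere c R))
    (hFu : ∀ i, ∀ z ∈ Metric.sphere c R, ‖F i z‖ ≤ u i)
    (hG : ∀ z ∈ Metric.sphere c R, HasSum (fun i => F i z) (G z)) :
    HasSum (fun i => ∮ z in C(c, R), F i z) (∮ z in C(c, R), G z) := by
  have hmem (θ : ℝ) := circleMap_mem_sphere c hR θ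
  refine intervalIntegral.hasSum_integral_of_dominated_convergence (fun i _ => R * u i)
    (fun i => ?_) (fun i => ?_) ?_ ?_ ?_
  · refine Continuous.aestronglyMeasurable ?_
    simp only [deriv_circleMap]
    exact ((continuous_circleMap _ _).mul continuous_const).smul
      ((hF i).comp_continuous (continuous_circleMap c R) hmem)
  · refine MeasureTheory.ae_of_all _ fun θ _ => ?_
    simpa [norm_smul, abs_of_nonneg hR] using mul_le_mul_of_nonneg_left (hFu i _ (hmem θ)) hR
  · exact MeasureTheory.ae_of_all _ fun θ _ => hu.mul_left R
  · exact intervalIntegrable_const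
  · exact MeasureTheory.ae_of_all _ fun θ _ => (hG _ (hmem θ)).const_smul _

theorem mem_closedBall_one_half_bounds {z : ℂ} (hz : z ∈ Metric.closedBall (1 : ℂ) (1 / 2)) :
    1 / 2 ≤ ‖z‖ ∧ ‖z‖ ≤ 3 / 2 ∧ z ∈ Complex.slitPlane := by
  rw [mem_closedBall_iff_norm] at hz
  have h1 := norm_sub_norm_le (1 : ℂ) z
  have h2 := norm_sub_norm_le z (1 : ℂ)
  rw [norm_sub_rev] at h1
  rw [norm_one] at h1 h2
  refine ⟨by linarith, by linarith, Or.inl ?_⟩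
  have := Complex.abs_re_le_norm (z - 1)
  rw [Complex.sub_re, Complex.one_re] at this
  linarith [(abs_le.1 (this.trans hz)).1]

/-- The integrand is a constant times `z^(r-1+2n-m) / (z-1)^(m+n+1)`, so Cauchy's formula for
derivatives applies; the binomial coefficient turns its `1/(m+n)!` into `1/(m! n!)`. -/
theorem circleIntegral_eq_hornG3PolyCoeff (r x y : ℂ) (m n : ℕ) :
    (∮ z in C(1, 1 / 2), ((m + n).choose m : ℂ) * (x / (z * (z - 1))) ^ m *
        (-y * z ^ 2 / (z - 1)) ^ n * (z ^ (r - 1) / (z - 1))) =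
      2 * Real.pi * Complex.I * (hornG3PolyCoeff r m n * x ^ m * y ^ n) := by
  have hd : DifferentiableOn ℂ (fun z : ℂ => z ^ (r - 1 + 2 * n - m))
      (Metric.closedBall 1 (1 / 2)) := fun z hz =>
    (differentiableAt_id.cpow_const (mem_closedBall_one_half_bounds hz).2.2).differentiableWithinAt
  have hc := hd.circleIntegral_one_div_sub_center_pow_smul (by norm_num) (m + n)
  rw [iteratedDeriv_cpow_const _ _ Complex.one_mem_slitPlane, Complex.one_cpow, mul_one] at hc
  have he : Set.EqOn (fun z : ℂ => ((m + n).choose m : ℂ) * (x / (z * (z - 1))) ^ m *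
        (-y * z ^ 2 / (z - 1)) ^ n * (z ^ (r - 1) / (z - 1)))
      (fun z => ((m + n).choose m * x ^ m * (-y) ^ n : ℂ) *
        ((1 / (z - 1) ^ (m + n + 1)) • z ^ (r - 1 + 2 * n - m))) (Metric.sphere 1 (1 / 2)) := by
    intro z hz
    have hz0 : z ≠ 0 :=
      Complex.slitPlane_ne_zero (mem_closedBall_one_half_bounds (Metric.sphere_subset_closedBall hz)).2.2
    have hz1 : z - 1 ≠ 0 := by
      rw [mem_sphere_iff_norm] at hz
      exact norm_pos_iff.1 (by rw [hz]; norm_num)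
    have hp : z ^ (r - 1 + 2 * n - m) = z ^ (r - 1) * z ^ (2 * n) / z ^ m := by
      rw [Complex.cpow_sub _ _ hz0, Complex.cpow_add _ _ hz0, Complex.cpow_natCast]
      congr 2
      exact_mod_cast Complex.cpow_natCast z (2 * n)
    simp only [hp, smul_eq_mul, div_pow, mul_pow]
    field_simp
    ring
  rw [circleIntegral.integral_congr (by norm_num) he, circleIntegral.integral_const_mul, hc,
    hornG3PolyCoeff, Nat.choose_symm_add, Nat.add_choose,
    Nat.cast_div (Nat.factorial_mul_factorial_dvd_factorial_add m n)
      (by exact_mod_cast mul_ne_zero (Nat.factorial_ne_zero m) (Nat.factorial_ne_zero n)), smul_eq_mul]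
  have h1 : (m.factorial : ℂ) ≠ 0 := by exact_mod_cast Nat.factorial_ne_zero m
  have h2 : (n.factorial : ℂ) ≠ 0 := by exact_mod_cast Nat.factorial_ne_zero n
  have h3 : ((m + n).factorial : ℂ) ≠ 0 := by exact_mod_cast Nat.factorial_ne_zero (m + n)
  rw [neg_pow y]
  push_cast
  field_simp

theorem hasSum_hornG3DiagTerm_of_root {x y w : ℂ} (hx : ‖x‖ < 1 / 40) (hy : ‖y‖ < 1 / 40)
    (hw : ‖w - 1‖ < 1 / 4) (hP : y * w ^ 3 + w ^ 2 - w - x = 0) (r : ℂ) :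
    HasSum (hornG3DiagTerm r x y) (w ^ r / (3 * y * w ^ 2 + 2 * w - 1)) := by
  have hwb : w ∈ Metric.ball (1 : ℂ) (1 / 2) := by
    rw [mem_ball_iff_norm]; linarith
  obtain ⟨-, hwn, -⟩ := mem_closedBall_one_half_bounds (Metric.ball_subset_closedBall hwb)
  -- The quotient of the cubic by `z - w`; hence `Q w` is the derivative of the cubic at `w`.
  set Q : ℂ → ℂ := fun z => y * z ^ 2 + (1 + y * w) * z + (y * w ^ 2 + w - 1) with hQdef
  -- A zero would satisfy `|z| ≤ (1/40)(27/4) + 1/4 < 1/2`, too small for this disc.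
  have hQ : ∀ z ∈ Metric.closedBall (1 : ℂ) (1 / 2), Q z ≠ 0 := by
    intro z hz h0
    obtain ⟨h1, h2, -⟩ := mem_closedBall_one_half_bounds hz
    have hzw : z = -(y * (z ^ 2 + w * z + w ^ 2) + (w - 1)) := by linear_combination h0
    have ha : ‖z ^ 2 + w * z + w ^ 2‖ ≤ 27 / 4 := by
      refine (norm_add₃_le).trans ?_
      rw [norm_pow, norm_mul, norm_pow]
      nlinarith [norm_nonneg z, norm_nonneg w]
    have hb : ‖z‖ ≤ ‖y‖ * ‖z ^ 2 + w * z + w ^ 2‖ + ‖w - 1‖ := by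
      conv_lhs => rw [hzw, norm_neg]
      exact (norm_add_le _ _).trans (by rw [norm_mul])
    nlinarith [norm_nonneg y, norm_nonneg (z ^ 2 + w * z + w ^ 2)]
  have hmem : ∀ z ∈ Metric.sphere (1 : ℂ) (1 / 2), z ∈ Complex.slitPlane ∧ z ≠ 0 ∧ z - 1 ≠ 0 ∧
      ‖x / (z * (z - 1))‖ ≤ 1 / 10 ∧ ‖-y * z ^ 2 / (z - 1)‖ ≤ 9 / 80 := by
    intro z hz
    obtain ⟨h1, h2, h3⟩ := mem_closedBall_one_half_bounds (Metric.sphere_subset_closedBall hz)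
    rw [mem_sphere_iff_norm] at hz
    refine ⟨h3, Complex.slitPlane_ne_zero h3, norm_pos_iff.1 (by rw [hz]; norm_num), ?_, ?_⟩
    · rw [norm_div, norm_mul, hz, div_le_iff₀ (by linarith)]
      linarith
    · rw [norm_div, norm_mul, norm_neg, norm_pow, hz, div_le_iff₀ (by norm_num)]
      nlinarith [norm_nonneg y, norm_nonneg z]
  have hK : ContinuousOn (fun z : ℂ => z ^ (r - 1) / (z - 1)) (Metric.sphere 1 (1 / 2)) := by
    intro z hz
    obtain ⟨h1, h2, h3, -⟩ := hmem z hz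
    exact ((continuousAt_id.cpow continuousAt_const h1).div
      (continuousAt_id.sub continuousAt_const) h3).continuousWithinAt
  -- Only `C` depends on `r`; the ratios `1/10` and `9/80` do not, so neither does the domain of
  -- validity.
  obtain ⟨C, hC⟩ := (isCompact_sphere (1 : ℂ) (1 / 2)).exists_bound_of_continuousOn hK
  have hsum := hasSum_circleIntegral_of_summable_norm (c := 1) (R := 1 / 2) (by norm_num)
    (F := fun (k : ℕ × ℕ) (z : ℂ) => ((k.1 + k.2).choose k.1 : ℂ) * (x / (z * (z - 1))) ^ k.1 *
        (-y * z ^ 2 / (z - 1)) ^ k.2 * (z ^ (r - 1) / (z - 1)))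
    (G := fun z => (1 - x / (z * (z - 1)) - -y * z ^ 2 / (z - 1))⁻¹ * (z ^ (r - 1) / (z - 1)))
    ((summable_choose_mul_pow_mul_pow (a := 1 / 10) (b := 9 / 80) (by norm_num) (by norm_num)
      (by norm_num)).mul_right C) ?_ ?_ ?_
  rotate_left
  · intro k
    refine ContinuousOn.mul ?_ hK
    intro z hz
    obtain ⟨h1, h2, h3, -⟩ := hmem z hz
    have : ContinuousAt (fun z : ℂ => ((k.1 + k.2).choose k.1 : ℂ) * (x / (z * (z - 1))) ^ k.1 *
        (-y * z ^ 2 / (z - 1)) ^ k.2) z := by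
      have := mul_ne_zero h2 h3
      fun_prop (disch := assumption)
    exact this.continuousWithinAt
  · intro k z hz
    obtain ⟨-, -, -, hA, hB⟩ := hmem z hz
    rw [norm_mul, norm_mul, norm_mul, norm_pow, norm_pow, Complex.norm_natCast]
    have := hC z hz
    gcongr
  · intro z hz
    obtain ⟨-, -, -, hA, hB⟩ := hmem z hz
    exact (hasSum_choose_mul_pow_mul_pow (by linarith)).mul_right _
  have hd : DifferentiableOn ℂ (fun z : ℂ => z ^ r / Q z) (Metric.closedBall 1 (1 / 2)) := by
    intro z hz
    refine DifferentiableAt.differentiableWithinAt ?_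
    refine (differentiableAt_id.cpow_const (mem_closedBall_one_half_bounds hz).2.2).div ?_ (hQ z hz)
    fun_prop
  have hI : (∮ z in C(1, 1 / 2),
      (1 - x / (z * (z - 1)) - -y * z ^ 2 / (z - 1))⁻¹ * (z ^ (r - 1) / (z - 1))) =
      2 * Real.pi * Complex.I * (w ^ r / Q w) := by
    rw [← smul_eq_mul (a := 2 * (Real.pi : ℂ) * Complex.I), ← hd.circleIntegral_sub_inv_smul hwb]
    refine circleIntegral.integral_congr (by norm_num) fun z hz => ?_
    obtain ⟨-, h2, h3, -⟩ := hmem z hz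
    have hzw : z - w ≠ 0 := sub_ne_zero.2 fun h => by
      rw [mem_sphere_iff_norm, h] at hz
      linarith
    have hq := hQ z (Metric.sphere_subset_closedBall hz)
    have hf : 1 - x / (z * (z - 1)) - -y * z ^ 2 / (z - 1) =
        ((z - w) * Q z) / (z * (z - 1)) := by
      field_simp
      simp only [hQdef]
      linear_combination hP
    simp only [hf, smul_eq_mul, Complex.cpow_sub _ _ h2, Complex.cpow_one]
    field_simp
  have hQw : Q w = 3 * y * w ^ 2 + 2 * w - 1 := by simp only [hQdef]; ring
  rw [hI, hQw] at hsum
  simp only [circleIntegral_eq_hornG3PolyCoeff] at hsum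
  have := (hasSum_mul_left_iff Complex.two_pi_I_ne_zero).1 hsum
  refine this.congr_fun fun k => ?_
  rw [hornG3DiagTerm, hornG3DiagCoeff_eq_polyCoeff]

/-! ### An identity theorem in several variables -/

/-- The set of points near which `F` vanishes is relatively closed in `U`: in a ball about a limit
point, the one-variable identity theorem spreads the zeros along complex lines. Differentiability on
lines suffices, and is easy to check for a power series. -/
theorem eq_zero_of_differentiableAt_lines {E : Type*} [NormedAddCommGroup E] [NormedSpace ℂ E]
    {U : Set E} (hU : IsOpen U) (hc : IsPreconnected U) {F : E → ℂ}
    (hF : ∀ p ∈ U, ∀ v : E, DifferentiableAt ℂ (fun t : ℂ => F (p + t • v)) 0)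
    {p₀ : E} (hp₀ : p₀ ∈ U) (h₀ : ∀ᶠ p in 𝓝 p₀, F p = 0) : ∀ p ∈ U, F p = 0 := by
  have key : U ⊆ {p | ∀ᶠ q in 𝓝 p, F q = 0} := by
    refine hc.subset_of_closure_inter_subset isOpen_setOfPred_eventually_nhds ⟨p₀, hp₀, h₀⟩ ?_
    rintro p ⟨hpc, hpU⟩
    obtain ⟨ε, hε, hball⟩ := Metric.isOpen_iff.1 hU p hpU
    obtain ⟨q, hq, hqp⟩ := Metric.mem_closure_iff.1 hpc ε hε
    rw [dist_comm] at hqp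
    filter_upwards [Metric.ball_mem_nhds p hε] with w hw
    set V : Set ℂ := {t | q + t • (w - q) ∈ Metric.ball p ε} with hV
    have hline : Continuous fun t : ℂ => q + t • (w - q) := by fun_prop
    have hVo : IsOpen V := Metric.isOpen_ball.preimage hline
    have hVc : Convex ℝ V := by
      intro t₁ h₁ t₂ h₂ a b ha hb hab
      have e : q + (a • t₁ + b • t₂) • (w - q) =
          a • (q + t₁ • (w - q)) + b • (q + t₂ • (w - q)) := by
        rw [smul_add, smul_add, add_add_add_comm, ← add_smul, hab, one_smul, add_smul,
          smul_assoc, smul_assoc]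
      simp only [hV, Set.mem_ofPred_eq, e]
      exact convex_ball p ε h₁ h₂ ha hb hab
    have hd : DifferentiableOn ℂ (fun t : ℂ => F (q + t • (w - q))) V := by
      intro t ht
      have h1 := hF _ (hball ht) (w - q)
      have h2 : DifferentiableAt ℂ (fun u : ℂ => u - t) t := by fun_prop
      have h3 := DifferentiableAt.comp t (by rwa [sub_self]) h2
      refine (h3.congr_of_eventuallyEq (.of_forall fun u => ?_)).differentiableWithinAt
      simp only [Function.comp, add_assoc, ← add_smul, add_sub_cancel]
    have h0 : (0 : ℂ) ∈ V := by simpa [hV] using hqp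
    have hz : (fun t : ℂ => F (q + t • (w - q))) =ᶠ[𝓝 0] 0 := by
      have : Tendsto (fun t : ℂ => q + t • (w - q)) (𝓝 0) (𝓝 q) := by
        simpa using hline.tendsto 0
      exact this.eventually hq
    have := (hd.analyticOnNhd hVo).eqOn_zero_of_preconnected_of_eventuallyEq_zero
      hVc.isPreconnected h0 hz (show (1 : ℂ) ∈ V by simpa [hV] using hw)
    simpa using this
  exact fun p hp => (key hp).self_of_nhds

theorem exists_norm_lt_of_pos (a : ℂ) {ε : ℝ} (hε : 0 < ε) : ∃ z : ℂ, ‖z - a‖ < ε ∧ ‖a‖ < ‖z‖ := by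
  by_cases ha : a = 0
  · refine ⟨(ε / 2 : ℝ), ?_, ?_⟩ <;> simp [ha, abs_of_pos hε] <;> linarith
  · have hn : 0 < ‖a‖ := norm_pos_iff.2 ha
    refine ⟨(1 + ε / (2 * ‖a‖) : ℝ) * a, ?_, ?_⟩
    · have : ((1 + ε / (2 * ‖a‖) : ℝ) : ℂ) * a - a = ((ε / (2 * ‖a‖) : ℝ) : ℂ) * a := by
        push_cast; ring
      rw [this, norm_mul, Complex.norm_real, Real.norm_of_nonneg (by positivity)]
      field_simp
      linarith
    · rw [norm_mul, Complex.norm_real, Real.norm_of_nonneg (by positivity)]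
      have : 0 < ε / (2 * ‖a‖) := by positivity
      nlinarith

/-- As `U` is open, it contains a point `(a, b)` with both coordinates larger in modulus than those
of `p`; absolute convergence there dominates the series uniformly near `p`. -/
theorem differentiableAt_tsum_hornG3DiagTerm {r : ℂ} {U : Set (ℂ × ℂ)} (hU : IsOpen U)
    (hs : ∀ p ∈ U, Summable (hornG3DiagTerm r p.1 p.2)) {p : ℂ × ℂ} (hp : p ∈ U) (v : ℂ × ℂ) :
    DifferentiableAt ℂ
      (fun t : ℂ => ∑' k, hornG3DiagTerm r (p + t • v).1 (p + t • v).2 k) 0 := by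
  obtain ⟨ε, hε, hball⟩ := Metric.isOpen_iff.1 hU p hp
  obtain ⟨a, ha, hpa⟩ := exists_norm_lt_of_pos p.1 hε
  obtain ⟨b, hb, hpb⟩ := exists_norm_lt_of_pos p.2 hε
  have hab : (a, b) ∈ U := hball <| by
    rw [mem_ball_iff_norm, Prod.norm_def]
    exact max_lt ha hb
  have hW : IsOpen {t : ℂ | ‖(p + t • v).1‖ < ‖a‖ ∧ ‖(p + t • v).2‖ < ‖b‖} := by
    have h1 : IsOpen {t : ℂ | ‖(p + t • v).1‖ < ‖a‖} := isOpen_lt (by fun_prop) (by fun_prop)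
    have h2 : IsOpen {t : ℂ | ‖(p + t • v).2‖ < ‖b‖} := isOpen_lt (by fun_prop) (by fun_prop)
    exact h1.inter h2
  refine (Complex.differentiableOn_tsum_of_summable_norm (hs _ hab).norm (fun k => ?_) hW
    fun k t ht => ?_).differentiableAt (hW.mem_nhds ⟨by simpa using hpa, by simpa using hpb⟩)
  · simp only [hornG3DiagTerm, Prod.fst_add, Prod.snd_add, Prod.smul_fst, Prod.smul_snd]
    fun_prop
  · obtain ⟨h1, h2⟩ := ht
    simp only [hornG3DiagTerm, norm_mul, norm_pow]
    gcongr

/-! ### The algebraic function -/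

/-- `g3Delta` is the discriminant of the cubic and `g3G` that of its quotient by `z - w`; the two
differ by the square of the quotient's value at `w`. -/
theorem g3G_mul_sq_eq_g3Delta {x y w : ℂ} (h : y * w ^ 3 + w ^ 2 - w - x = 0) :
    g3G y w * (3 * y * w ^ 2 + 2 * w - 1) ^ 2 = g3Delta x y := by
  obtain rfl : x = y * w ^ 3 + w ^ 2 - w := by linear_combination -h
  unfold g3G g3Delta
  ring

theorem exists_g3Root_near_zero :
    ∃ f : ℂ × ℂ → ℂ, f (0, 0) = 1 ∧ ∀ᶠ p : ℂ × ℂ in 𝓝 (0, 0),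
      DifferentiableAt ℂ f p ∧ p.2 * f p ^ 3 + f p ^ 2 - f p - p.1 = 0 := by
  set Φ : ℂ × ℂ → ℂ × ℂ := fun q => (q.2 * q.1 ^ 3 + q.1 ^ 2 - q.1, q.2) with hΦ
  let fst := ContinuousLinearMap.fst ℂ ℂ ℂ
  let snd := ContinuousLinearMap.snd ℂ ℂ ℂ
  -- The derivative of `Φ` at `(1, 0)`, namely `(u, v) ↦ (u + v, v)`; the root is the first
  -- component of the local inverse of `Φ`.
  let e : (ℂ × ℂ) ≃L[ℂ] (ℂ × ℂ) :=
    ContinuousLinearEquiv.equivOfInverse ((fst + snd).prod snd) ((fst - snd).prod snd)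
      (fun q => by simp [fst, snd]) (fun q => by simp [fst, snd])
  have hcd : ContDiffAt ℂ 1 Φ (1, 0) := by
    have : ContDiff ℂ 1 Φ := by rw [hΦ]; fun_prop
    exact this.contDiffAt
  have hd : HasFDerivAt Φ (e : (ℂ × ℂ) →L[ℂ] (ℂ × ℂ)) (1, 0) := by
    have h1 : HasFDerivAt (fun q : ℂ × ℂ => q.1) fst (1, 0) := hasFDerivAt_fst
    have h2 : HasFDerivAt (fun q : ℂ × ℂ => q.2) snd (1, 0) := hasFDerivAt_snd
    convert! (((h2.mul (h1.pow 3)).add (h1.pow 2)).sub h1).prodMk h2 using 1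
    ext <;> simp [e, fst, snd] <;> norm_num
  have hΦ1 : Φ (1, 0) = (0, 0) := by simp [hΦ]
  have hs := hcd.hasStrictFDerivAt' hd one_ne_zero
  have hinv := hcd.to_localInverse hd one_ne_zero
  have hr := hs.eventually_right_inverse
  have h0 := hcd.localInverse_apply_image hd one_ne_zero
  rw [hΦ1] at hinv hr h0
  refine ⟨fun p => (hcd.localInverse hd one_ne_zero p).1, congrArg Prod.fst h0, ?_⟩
  filter_upwards [hinv.eventually (by simp), hr] with p hp hq
  refine ⟨(hp.differentiableAt one_ne_zero).fst, ?_⟩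
  have hq1 := congrArg Prod.fst hq
  have hq2 := congrArg Prod.snd hq
  simp only [hΦ] at hq1 hq2
  rw [hq2] at hq1
  exact sub_eq_zero.2 hq1

theorem tendsto_g3_data {f : ℂ × ℂ → ℂ} (hf : ContinuousAt f (0, 0)) (h1 : f (0, 0) = 1) :
    Tendsto (fun p => 3 * p.2 * f p ^ 2 + 2 * f p - 1) (𝓝 (0, 0)) (𝓝 1) ∧
    Tendsto (fun p : ℂ × ℂ => g3Delta p.1 p.2) (𝓝 (0, 0)) (𝓝 1) ∧
    Tendsto (fun p => g3G p.2 (f p)) (𝓝 (0, 0)) (𝓝 1) := by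
  refine ⟨?_, ?_, ?_⟩
  · have : ContinuousAt (fun p => 3 * p.2 * f p ^ 2 + 2 * f p - 1) (0, 0) := by fun_prop
    convert this.tendsto using 2
    rw [h1]; norm_num
  · have : Continuous (fun p : ℂ × ℂ => g3Delta p.1 p.2) := by unfold g3Delta; fun_prop
    convert this.tendsto (0, 0) using 2
    simp [g3Delta]
  · have : ContinuousAt (fun p => g3G p.2 (f p)) (0, 0) := by unfold g3G; fun_prop
    convert this.tendsto using 2
    simp [g3G]

/-! ### The formula near the origin and its continuation -/

theorem eventually_hasSum_hornG3DiagTerm {f : ℂ × ℂ → ℂ} (hf : ContinuousAt f (0, 0))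
    (h1 : f (0, 0) = 1)
    (hP : ∀ᶠ p : ℂ × ℂ in 𝓝 (0, 0), p.2 * f p ^ 3 + f p ^ 2 - f p - p.1 = 0) :
    ∀ᶠ p : ℂ × ℂ in 𝓝 (0, 0), ∀ r : ℂ,
      HasSum (hornG3DiagTerm r p.1 p.2) (f p ^ r / (3 * p.2 * f p ^ 2 + 2 * f p - 1)) := by
  have hx : ∀ᶠ p : ℂ × ℂ in 𝓝 (0, 0), p ∈ Metric.ball ((0, 0) : ℂ × ℂ) (1 / 40) :=
    Metric.ball_mem_nhds _ (by norm_num)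
  have hw : ∀ᶠ p : ℂ × ℂ in 𝓝 (0, 0), f p ∈ Metric.ball (1 : ℂ) (1 / 4) :=
    hf.eventually (by rw [h1]; exact Metric.ball_mem_nhds _ (by norm_num))
  filter_upwards [hx, hw, hP] with p hx hw hP r
  rw [← ball_prod_same] at hx
  exact hasSum_hornG3DiagTerm_of_root (mem_ball_zero_iff.1 hx.1) (mem_ball_zero_iff.1 hx.2)
    (mem_ball_iff_norm.1 hw) hP r

theorem exists_bidisc_hasSum_hornG3DiagTerm :
    ∃ ρ : ℝ, 0 < ρ ∧ ∃ f : ℂ × ℂ → ℂ,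
      IsG3Root (Metric.ball 0 ρ ×ˢ Metric.ball 0 ρ) f ∧
      ∀ x y : ℂ, ‖x‖ < ρ → ‖y‖ < ρ →
        f (x, y) ∈ Complex.slitPlane ∧ g3Delta x y ≠ 0 ∧
        g3G y (f (x, y)) / g3Delta x y ∈ Complex.slitPlane ∧
        ∀ r : ℂ, HasSum (hornG3DiagTerm r x y)
          (f (x, y) ^ r * (g3G y (f (x, y)) / g3Delta x y) ^ (1 / 2 : ℂ)) := by
  obtain ⟨f, hf1, hf⟩ := exists_g3Root_near_zero
  have hfc : ContinuousAt f (0, 0) := hf.self_of_nhds.1.continuousAt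
  obtain ⟨hD, hΔ, hG⟩ := tendsto_g3_data hfc hf1
  have hslit := Complex.isOpen_slitPlane.mem_nhds Complex.one_mem_slitPlane
  have hfs : ∀ᶠ p in 𝓝 (0, 0), f p ∈ Complex.slitPlane := hfc.eventually (by rwa [hf1])
  have hGs := (hG.div hΔ one_ne_zero).eventually (by rwa [div_one])
  -- Positive real part of `1/P'(f)` makes it the principal square root of its own square.
  have hre : ∀ᶠ z : ℂ in 𝓝 1, 0 < z.re :=
    Complex.continuous_re.continuousAt.eventually (lt_mem_nhds (by simp))
  have hDs := (hD.inv₀ one_ne_zero).eventually (by rwa [inv_one])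
  have hΔs := hΔ.eventually_ne one_ne_zero
  obtain ⟨ρ, hρ, h⟩ := Metric.eventually_nhds_iff_ball.1
    (hf.and <| hfs.and <| hGs.and <| hDs.and <| hΔs.and <|
      eventually_hasSum_hornG3DiagTerm hfc hf1 (hf.mono fun _ h => h.2))
  rw [← ball_prod_same] at h
  refine ⟨ρ, hρ, f, ⟨fun p hp => (h p hp).1.1.differentiableWithinAt,
    fun p hp => (h p hp).1.2, hf1⟩, fun x y hx hy => ?_⟩
  obtain ⟨⟨-, hP⟩, h1, h2, h3, h4, h5⟩ :=
    h (x, y) ⟨mem_ball_zero_iff.2 hx, mem_ball_zero_iff.2 hy⟩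
  refine ⟨h1, h4, h2, fun r => ?_⟩
  have e := g3G_mul_sq_eq_g3Delta hP
  have hne : 3 * y * f (x, y) ^ 2 + 2 * f (x, y) - 1 ≠ 0 := fun h0 => by
    rw [h0] at e
    exact h4 (by rw [← e]; ring)
  have e' : g3G y (f (x, y)) / g3Delta x y = ((3 * y * f (x, y) ^ 2 + 2 * f (x, y) - 1)⁻¹) ^ 2 := by
    rw [div_eq_iff h4, ← e, mul_left_comm, ← mul_pow, inv_mul_cancel₀ hne, one_pow, mul_one]
  rw [e', one_div, Complex.sq_cpow_two_inv h3, ← div_eq_mul_inv]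
  exact h5 r

theorem hasSum_hornG3DiagTerm_of_branches (r : ℂ) (U : Set (ℂ × ℂ)) (f l s : ℂ × ℂ → ℂ)
    (hU : IsOpen U) (hc : IsPreconnected U) (h0 : (0, 0) ∈ U)
    (hsum : ∀ p ∈ U, Summable (hornG3DiagTerm r p.1 p.2)) (hf : IsG3Root U f)
    (hl : DifferentiableOn ℂ l U) (hexp : ∀ p ∈ U, Complex.exp (l p) = f p) (hl0 : l (0, 0) = 0)
    (hs : DifferentiableOn ℂ s U) (hsq : ∀ p ∈ U, s p ^ 2 * g3Delta p.1 p.2 = g3G p.2 (f p))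
    (hs0 : s (0, 0) = 1) :
    ∀ p ∈ U, HasSum (hornG3DiagTerm r p.1 p.2) (Complex.exp (r * l p) * s p) := by
  have hUn := hU.mem_nhds h0
  have hfc := (hf.holo.differentiableAt hUn).continuousAt
  have hlc := (hl.differentiableAt hUn).continuousAt
  have hsc := (hs.differentiableAt hUn).continuousAt
  obtain ⟨hD, hΔ, -⟩ := tendsto_g3_data hfc hf.base
  have hnear : ∀ᶠ p : ℂ × ℂ in 𝓝 (0, 0),
      (∑' k, hornG3DiagTerm r p.1 p.2 k) - Complex.exp (r * l p) * s p = 0 := by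
    -- This makes `l` the principal logarithm of `f` near the origin.
    have him : ∀ᶠ p in 𝓝 (0, 0), |(l p).im| < Real.pi := by
      have : ContinuousAt (fun p => |(l p).im|) (0, 0) :=
        (Complex.continuous_im.continuousAt.comp hlc).abs
      exact this.eventually (gt_mem_nhds (by simp [hl0, Real.pi_pos]))
    -- The product squares to `1` and tends to `1`; excluding `-1` fixes the sign of `s`.
    have hsD : ∀ᶠ p in 𝓝 (0, 0), s p * (3 * p.2 * f p ^ 2 + 2 * f p - 1) ≠ -1 := by
      have := hsc.tendsto.mul hD
      rw [hs0, one_mul] at this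
      exact this.eventually_ne (by norm_num)
    filter_upwards [hUn, him, hsD, hΔ.eventually_ne one_ne_zero,
      eventually_hasSum_hornG3DiagTerm hfc hf.base
        (eventually_of_mem hUn fun p hp => hf.cubic p hp)] with p hp him hsD hΔ hS
    have e := g3G_mul_sq_eq_g3Delta (hf.cubic p hp)
    have e2 : (s p * (3 * p.2 * f p ^ 2 + 2 * f p - 1)) ^ 2 = 1 := by
      refine mul_right_cancel₀ hΔ ?_
      rw [mul_pow, mul_right_comm, hsq p hp, e, one_mul]
    have e3 := (sq_eq_sq_iff_eq_or_eq_neg.1 (e2.trans (one_pow 2).symm)).resolve_right hsD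
    have hpow : f p ^ r = Complex.exp (r * l p) := by
      rw [← hexp p hp, Complex.cpow_def_of_ne_zero (Complex.exp_ne_zero _),
        Complex.log_exp (abs_lt.1 him).1 (abs_lt.1 him).2.le, mul_comm]
    rw [(hS r).tsum_eq, hpow, eq_inv_of_mul_eq_one_left e3, div_eq_mul_inv, sub_self]
  intro p hp
  have hzero := eq_zero_of_differentiableAt_lines hU hc
    (F := fun p => (∑' k, hornG3DiagTerm r p.1 p.2 k) - Complex.exp (r * l p) * s p)
    (fun q hq v => ?_) h0 hnear p hp
  · rw [← sub_eq_zero.1 hzero]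
    exact (hsum p hp).hasSum
  · have hq' : U ∈ 𝓝 (q + (0 : ℂ) • v) := by simpa using hU.mem_nhds hq
    have hline : DifferentiableAt ℂ (fun t : ℂ => q + t • v) 0 := by fun_prop
    have hl' : DifferentiableAt ℂ (fun t : ℂ => l (q + t • v)) 0 :=
      (hl.differentiableAt hq').comp (0 : ℂ) hline
    have hs' : DifferentiableAt ℂ (fun t : ℂ => s (q + t • v)) 0 :=
      (hs.differentiableAt hq').comp (0 : ℂ) hline
    exact (differentiableAt_tsum_hornG3DiagTerm hU hsum hq v).sub
      ((hl'.const_mul r).cexp.mul hs')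

theorem mainTheorem1 :
    -- the coefficients of `G₃(r, 1 - r | x, y)` are well defined for all complex `r`,
    -- and for non-integral `r` they are those of the Horn series
    (∀ (r : ℂ) (m n : ℕ), Tendsto (fun s : ℂ => hornG3Coeff s (1 - s) m n) (𝓝[≠] r)
      (𝓝 (hornG3DiagCoeff r m n))) ∧
    (∀ r : ℂ, (∀ k : ℤ, r ≠ k) → ∀ m n : ℕ,
      hornG3DiagCoeff r m n = hornG3Coeff r (1 - r) m n) ∧
    -- the formula near the origin, with principal powers, in a bidisc that does not depend on `r`
    (∃ ρ : ℝ, 0 < ρ ∧ ∃ f : ℂ × ℂ → ℂ,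
      IsG3Root (Metric.ball 0 ρ ×ˢ Metric.ball 0 ρ) f ∧
      ∀ x y : ℂ, ‖x‖ < ρ → ‖y‖ < ρ →
        f (x, y) ∈ Complex.slitPlane ∧ g3Delta x y ≠ 0 ∧
        g3G y (f (x, y)) / g3Delta x y ∈ Complex.slitPlane ∧
        ∀ r : ℂ, HasSum (hornG3DiagTerm r x y)
          (f (x, y) ^ r * (g3G y (f (x, y)) / g3Delta x y) ^ (1 / 2 : ℂ))) ∧
    -- the formula on every domain of convergence that carries holomorphic branches of the
    -- root `f`, of `log f` and of the square root of `g / Δ`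
    (∀ (r : ℂ) (U : Set (ℂ × ℂ)) (f l s : ℂ × ℂ → ℂ),
      IsOpen U → IsPreconnected U → (0, 0) ∈ U →
      (∀ p ∈ U, Summable (hornG3DiagTerm r p.1 p.2)) →
      IsG3Root U f →
      DifferentiableOn ℂ l U → (∀ p ∈ U, Complex.exp (l p) = f p) → l (0, 0) = 0 →
      DifferentiableOn ℂ s U → (∀ p ∈ U, s p ^ 2 * g3Delta p.1 p.2 = g3G p.2 (f p)) →
      s (0, 0) = 1 →
      ∀ p ∈ U, HasSum (hornG3DiagTerm r p.1 p.2) (Complex.exp (r * l p) * s p)) := by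
  refine ⟨fun r m n => ?_, fun r hr m n => ?_, exists_bidisc_hasSum_hornG3DiagTerm,
    hasSum_hornG3DiagTerm_of_branches⟩
  · rw [hornG3DiagCoeff_eq_polyCoeff]
    exact tendsto_hornG3Coeff r m n
  · rw [hornG3DiagCoeff_eq_polyCoeff, hornG3Coeff_eq_polyCoeff hr]
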